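/- Let $\Gamma$ be a finite simplicial graph whose edges $e$ are labelled by arbitrary integers $m_e\ge 2$, and let $$A_\Gamma=\langle V(\Gamma)\mid \langle v,w\rangle^{m_e}=\langle w,v\rangle^{m_e}\text{ for every edge } e=\{v,w\}\rangle$$ be the associated Artin group, where $\langle v,w\rangle^{m}=vwv\cdots$ denotes the alternating product of length $m$ starting with $v$. If $\Gamma$ is a tree, then $A_\Gamma$ is normally poly-free, i.e. there is a finite chain of subgroups $1=G_0\le G_1\le\cdots\le G_n=A_\Gamma$ such that each $G_i$ is normal in $A_\Gamma$ and each quotient $G_i/G_{i-1}$ ($1\le i\le n$) is a free group of possibly infinite rank. -/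

import Mathlib

/-- The alternating product `⟨a, b⟩^m = a b a ⋯` with exactly `m` factors, starting with `a`. -/
def altProd {M : Type*} [Monoid M] : M → M → ℕ → M
  | _, _, 0 => 1
  | a, b, m + 1 => a * altProd b a m

/-- The relators `⟨v, w⟩^m (⟨w, v⟩^m)⁻¹`, one for each ordered pair `(v, w)` of adjacent vertices,
where `m` is the label of the edge joining `v` and `w`. -/
def artinRelators {V : Type*} (Γ : SimpleGraph V) (m : Γ.edgeSet → ℕ) : Set (FreeGroup V) :=
  {r | ∃ (v w : V) (h : Γ.Adj v w),
    r = altProd (FreeGroup.of v) (FreeGroup.of w) (m ⟨s(v, w), h⟩) *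
      (altProd (FreeGroup.of w) (FreeGroup.of v) (m ⟨s(v, w), h⟩))⁻¹}

/-- The Artin group of the graph `Γ` with edges labelled by `m`: generators are the vertices,
with the relation `⟨v, w⟩^{m_e} = ⟨w, v⟩^{m_e}` for each edge `e = {v, w}`. -/
abbrev ArtinGroup {V : Type*} (Γ : SimpleGraph V) (m : Γ.edgeSet → ℕ) : Type _ :=
  PresentedGroup (artinRelators Γ m)

/-- A group `G` is normally poly-free if there is a finite chain of subgroups
`1 = G₀ ≤ G₁ ≤ ⋯ ≤ Gₙ = G`, each normal in `G`, whose successive quotients `Gᵢ₊₁ / Gᵢ` are free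
groups (of possibly infinite rank). -/
def IsNormallyPolyFree (G : Type*) [Group G] : Prop :=
  ∃ (n : ℕ) (H : Fin (n + 1) → Subgroup G) (_ : ∀ i, (H i).Normal),
    H 0 = ⊥ ∧ H (Fin.last n) = ⊤ ∧
      ∀ i : Fin n, H i.castSucc ≤ H i.succ ∧
        IsFreeGroup (H i.succ ⧸ (H i.castSucc).subgroupOf (H i.succ))

/-!
The relation of an edge `{a, b}` with label `m` says precisely that there are elements `c i`,
indexed by `i : ZMod m`, with `c 0 = a` and `c 1 = b`, such that the product `c i * c (i + 1)` does
not depend on `i` (the atoms of the dual Garside structure of a dihedral Artin group). On an edge of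
a tree, directed away from a root `r`, the kernel of the exponent sum is therefore generated by the
elements `c i * (c 0)⁻¹` with `i ≠ 0`, and the equations `c i * c (i + 1) = c (-1) * c 0` only
describe how `c 0` conjugates these generators. Since `c 0 * r⁻¹` is a word in the generators that
belong to edges closer to the root, the equations for all edges together amount to the action of `r`
on the kernel. So the kernel is free on these generators, and the Artin group is the mapping torus
of an automorphism of a free group.

A forest becomes a tree when a new vertex is joined to one vertex of each component by edges that
impose no relation. This enlarges the Artin group by a free factor, and the kernel of the exponent
sum embeds into the one for the tree.
-/

section BraidRelation

/-- The relation `⟨a, b⟩ᵐ = ⟨b, a⟩ᵐ` of an Artin group, for an edge with label `m`. It is empty for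
`m = 0` and identifies `a` with `b` for `m = 1`. -/
def BraidRel {M : Type*} [Monoid M] (a b : M) (m : ℕ) : Prop :=
  altProd a b m = altProd b a m

theorem BraidRel.symm {M : Type*} [Monoid M] {a b : M} {m : ℕ} (h : BraidRel a b m) :
    BraidRel b a m :=
  Eq.symm h

theorem BraidRel.refl {M : Type*} [Monoid M] (a : M) (m : ℕ) : BraidRel a a m :=
  rfl

theorem braidRel_zero {M : Type*} [Monoid M] (a b : M) : BraidRel a b 0 :=
  rfl

theorem map_altProd {M N : Type*} [Monoid M] [Monoid N] (f : M →* N) (a b : M) (m : ℕ) :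
    f (altProd a b m) = altProd (f a) (f b) m := by
  induction m generalizing a b with
  | zero => exact map_one f
  | succ m ih => rw [altProd, altProd, map_mul, ih]

theorem altProd_two_mul {M : Type*} [Monoid M] (a b : M) (k : ℕ) :
    altProd a b (2 * k) = (a * b) ^ k := by
  induction k with
  | zero => rw [mul_zero, pow_zero, altProd]
  | succ k ih => rw [Nat.mul_succ, altProd, altProd, ih, pow_succ', mul_assoc]

theorem altProd_two_mul_add_one {M : Type*} [Monoid M] (a b : M) (k : ℕ) :
    altProd a b (2 * k + 1) = (a * b) ^ k * a := by
  rw [altProd, altProd_two_mul, mul_pow_mul]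

variable {G : Type*} [Group G]

/-- The right complement `z ↦ z⁻¹δ` of Garside theory, characterised by
`z * complement δ z = δ`. -/
def complement (δ : G) : Equiv.Perm G :=
  (Equiv.inv G).trans (Equiv.mulRight δ)

theorem complement_apply (δ z : G) : complement δ z = z⁻¹ * δ := rfl

theorem complement_pow_two_mul_apply (δ z : G) (k : ℕ) :
    (complement δ ^ (2 * k)) z = (δ ^ k)⁻¹ * z * δ ^ k := by
  induction k with
  | zero => simp
  | succ k ih =>
    rw [Nat.mul_succ, add_comm, pow_add, Equiv.Perm.mul_apply, ih, sq, Equiv.Perm.mul_apply,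
      complement_apply, complement_apply]
    group

theorem braidRel_iff_complement_pow (x y : G) (m : ℕ) :
    BraidRel x y m ↔ (complement (x * y) ^ m) x = x := by
  obtain ⟨k, rfl | rfl⟩ := Nat.even_or_odd' m
  · rw [BraidRel, altProd_two_mul, altProd_two_mul, complement_pow_two_mul_apply, mul_assoc,
      inv_mul_eq_iff_eq_mul, mul_pow_mul, mul_right_inj]
  · rw [BraidRel, altProd_two_mul_add_one, altProd_two_mul_add_one, mul_pow_mul y, pow_succ,
      Equiv.Perm.mul_apply, complement_apply, inv_mul_cancel_left, complement_pow_two_mul_apply,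
      mul_assoc, inv_mul_eq_iff_eq_mul, eq_comm]

theorem pow_apply_eq_self_iff_exists_zmod {α : Type*} (σ : Equiv.Perm α) (x : α) (m : ℕ) :
    (σ ^ m) x = x ↔ ∃ c : ZMod m → α, c 0 = x ∧ ∀ i, c (i + 1) = σ (c i) := by
  constructor
  · intro hx
    have hperiod (a : ℤ) (ha : (a : ZMod m) = 0) : (σ ^ a) x = x := by
      obtain ⟨k, rfl⟩ := (ZMod.intCast_zmod_eq_zero_iff_dvd a m).1 ha
      rw [zpow_mul, zpow_natCast]
      exact Equiv.Perm.zpow_apply_eq_self_of_apply_eq_self hx k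
    refine ⟨fun i => (σ ^ (i.cast : ℤ)) x, hperiod _ (by simp), fun i => ?_⟩
    have hsucc : ((-(i + 1).cast + (1 + i.cast) : ℤ) : ZMod m) = 0 := by
      rw [Int.cast_add, Int.cast_neg, Int.cast_add, Int.cast_one, ZMod.intCast_zmod_cast,
        ZMod.intCast_zmod_cast, add_comm 1, neg_add_cancel]
    rw [← Equiv.Perm.mul_apply, ← zpow_one_add, eq_comm, ← Equiv.Perm.inv_eq_iff_eq,
      ← zpow_neg, ← Equiv.Perm.mul_apply, ← zpow_add]
    exact hperiod _ hsucc
  · rintro ⟨c, rfl, hc⟩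
    have hpow (n : ℕ) : (σ ^ n) (c 0) = c n := by
      induction n with
      | zero => simp
      | succ n ih => rw [pow_succ', Equiv.Perm.mul_apply, ih, ← hc, Nat.cast_succ]
    rw [hpow, ZMod.natCast_self]

theorem braidRel_iff_exists_zmod (x y : G) (m : ℕ) :
    BraidRel x y m ↔ ∃ c : ZMod m → G, c 0 = x ∧ c 1 = y ∧ ∀ i, c i * c (i + 1) = x * y := by
  rw [braidRel_iff_complement_pow, pow_apply_eq_self_iff_exists_zmod]
  simp only [complement_apply, eq_inv_mul_iff_mul_eq]
  refine exists_congr fun c => and_congr_right fun h0 => (and_iff_right_of_imp fun hc => ?_).symm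
  rw [← mul_right_inj x, ← hc 0, zero_add, h0]

end BraidRelation

section MappingTorus

variable {N : Type*} [Group N]

/-- The mapping torus of an automorphism: the extension of `ℤ` by `N` in which the generator of `ℤ`
acts on `N` by `σ`. -/
abbrev MappingTorus (σ : MulAut N) : Type _ :=
  N ⋊[zpowersHom (MulAut N) σ] Multiplicative ℤ

theorem map_zpow_mulAut_apply {K : Type*} [Group K] (σ : MulAut N) (f : N →* K) (t : K)
    (h : ∀ x, f (σ x) = t * f x * t⁻¹) (n : ℤ) (x : N) :
    f ((σ ^ n) x) = t ^ n * f x * (t ^ n)⁻¹ := by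
  induction n generalizing x with
  | zero => simp
  | succ n ih =>
    rw [zpow_add_one, MulAut.mul_apply, ih, h, zpow_add_one]
    group
  | pred n ih =>
    have hinv : f (σ⁻¹ x) = t⁻¹ * f x * t := by
      rw [← MulAut.apply_inv_self N σ x, h, MulAut.inv_apply_self]
      group
    rw [zpow_sub_one, MulAut.mul_apply, ih, hinv, zpow_sub_one]
    group

/-- The homomorphism on a mapping torus given by `f` on the fiber and by the image `t` of the
generator of `ℤ`. -/
def MappingTorus.lift {K : Type*} [Group K] {σ : MulAut N} (f : N →* K) (t : K)
    (h : ∀ x, f (σ x) = t * f x * t⁻¹) : MappingTorus σ →* K :=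
  SemidirectProduct.lift f (zpowersHom K t) fun n =>
    MonoidHom.ext fun x => map_zpow_mulAut_apply σ f t h n.toAdd x

end MappingTorus

/-- A tree with vertex set `Option V`, rooted at `none`, in which an edge with label `label v` joins
`some v` to `parent v`. The function `depth` witnesses that the tree is well-founded; it need not be
the distance from the root. -/
structure LabelledRootedTree (V : Type*) where
  parent : V → Option V
  label : V → ℕ
  depth : Option V → ℕ
  depth_parent_lt : ∀ v, depth (parent v) < depth (some v)

namespace LabelledRootedTree

variable {V : Type*} (T : LabelledRootedTree V)

theorem parent_induction {P : Option V → Prop} (root : P none)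
    (child : ∀ v, P (T.parent v) → P (some v)) : ∀ o, P o
  | none => root
  | some v => child v (parent_induction root child (T.parent v))
termination_by o => T.depth o
decreasing_by exact T.depth_parent_lt v

/-- The fiber of the exponent sum on the Artin group of `T`. If `c i`, for `i : ZMod (label v)`, are
the atoms of the dihedral Artin group of the edge above `v`, starting with `c 0 = parent v` and
`c 1 = v`, then the generator `⟨v, i⟩` stands for `c i * (c 0)⁻¹`. -/
abbrev FreeFiber : Type _ := FreeGroup (Σ v, {i : ZMod (T.label v) // i ≠ 0})

namespace FreeFiber

variable {T}

/-- The generator `⟨v, i⟩` of the fiber, understood to be trivial for `i = 0`. -/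
def gen (v : V) (i : ZMod (T.label v)) : T.FreeFiber :=
  if h : i = 0 then 1 else FreeGroup.of ⟨v, i, h⟩

@[simp] theorem gen_zero (v : V) : gen (T := T) v 0 = 1 := dif_pos rfl

theorem gen_of_ne_zero (v : V) {i : ZMod (T.label v)} (h : i ≠ 0) :
    gen v i = FreeGroup.of ⟨v, i, h⟩ := dif_neg h

variable {K : Type*} [Group K]

theorem hom_ext {f g : T.FreeFiber →* K} (h : ∀ v i, f (gen v i) = g (gen v i)) : f = g :=
  FreeGroup.ext_hom _ _ fun ⟨v, i, hi⟩ => by simpa only [gen_of_ne_zero v hi] using h v i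

/-- The homomorphism on the fiber that sends `gen v i` to `c v i`, provided that `c v 0 = 1`. -/
def lift (c : ∀ v, ZMod (T.label v) → K) : T.FreeFiber →* K :=
  FreeGroup.lift fun x => c x.1 x.2

theorem lift_gen (c : ∀ v, ZMod (T.label v) → K) (hc : ∀ v, c v 0 = 1) (v : V)
    (i : ZMod (T.label v)) : lift c (gen v i) = c v i := by
  by_cases h : i = 0
  · rw [h, gen_zero, map_one, hc]
  · rw [gen_of_ne_zero v h, lift, FreeGroup.lift_apply_of]

end FreeFiber

open FreeFiber

/-- The element `o * root⁻¹` of the fiber. -/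
def offset : Option V → T.FreeFiber
  | none => 1
  | some v => gen v 1 * offset (T.parent v)
termination_by o => T.depth o
decreasing_by exact T.depth_parent_lt v

/-- The element `root⁻¹ * o` of the fiber, the preimage of `offset o` under conjugation by the
root. -/
def coOffset : Option V → T.FreeFiber
  | none => 1
  | some v => coOffset (T.parent v) * (gen v 1 * (gen v (1 + 1))⁻¹)
termination_by o => T.depth o
decreasing_by exact T.depth_parent_lt v

@[simp] theorem offset_none : T.offset none = 1 := by rw [offset]

theorem offset_some (v : V) : T.offset (some v) = gen v 1 * T.offset (T.parent v) := by
  rw [offset]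

@[simp] theorem coOffset_none : T.coOffset none = 1 := by rw [coOffset]

theorem coOffset_some (v : V) :
    T.coOffset (some v) = T.coOffset (T.parent v) * (gen v 1 * (gen v (1 + 1))⁻¹) := by
  rw [coOffset]

/-- Conjugation by the root on the fiber. With `c` as for `FreeFiber`, conjugation by `c 0` maps
`c i * (c 0)⁻¹` to `(c (i - 1))⁻¹ * c (-1)`, because the products `c (i - 1) * c i` and
`c (-1) * c 0` agree, and the root is `(offset (parent v))⁻¹ * c 0`. -/
def rootConj : T.FreeFiber →* T.FreeFiber :=
  FreeFiber.lift fun v i =>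
    (T.offset (T.parent v))⁻¹ * ((gen v (i - 1))⁻¹ * gen v (-1)) * T.offset (T.parent v)

/-- Conjugation by the inverse of the root on the fiber. -/
def rootConjInv : T.FreeFiber →* T.FreeFiber :=
  FreeFiber.lift fun v i =>
    T.coOffset (T.parent v) * (gen v 1 * (gen v (i + 1))⁻¹) * (T.coOffset (T.parent v))⁻¹

theorem rootConj_gen (v : V) (i : ZMod (T.label v)) :
    T.rootConj (gen v i) =
      (T.offset (T.parent v))⁻¹ * ((gen v (i - 1))⁻¹ * gen v (-1)) * T.offset (T.parent v) :=
  FreeFiber.lift_gen _ (fun v => by simp) v i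

theorem rootConjInv_gen (v : V) (i : ZMod (T.label v)) :
    T.rootConjInv (gen v i) =
      T.coOffset (T.parent v) * (gen v 1 * (gen v (i + 1))⁻¹) * (T.coOffset (T.parent v))⁻¹ :=
  FreeFiber.lift_gen _ (fun v => by simp) v i

theorem rootConj_coOffset (o : Option V) : T.rootConj (T.coOffset o) = T.offset o := by
  induction o using T.parent_induction with
  | root => simp
  | child v ih =>
    rw [coOffset_some, offset_some, map_mul, ih, map_mul, map_inv, rootConj_gen, rootConj_gen,
      sub_self, add_sub_cancel_right, gen_zero]
    group

theorem rootConjInv_offset (o : Option V) : T.rootConjInv (T.offset o) = T.coOffset o := by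
  induction o using T.parent_induction with
  | root => simp
  | child v ih =>
    rw [coOffset_some, offset_some, map_mul, ih, rootConjInv_gen, inv_mul_cancel_right]

/-- The action of the root on the fiber by conjugation. -/
def monodromy : MulAut T.FreeFiber :=
  MonoidHom.toMulEquiv T.rootConj T.rootConjInv
    (FreeFiber.hom_ext fun v i => by
      simp only [MonoidHom.comp_apply, MonoidHom.id_apply, rootConj_gen, map_mul, map_inv,
        rootConjInv_offset, rootConjInv_gen, sub_add_cancel, neg_add_cancel, gen_zero]
      group)
    (FreeFiber.hom_ext fun v i => by
      simp only [MonoidHom.comp_apply, MonoidHom.id_apply, rootConjInv_gen, map_mul, map_inv,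
        rootConj_coOffset, rootConj_gen, sub_self, add_sub_cancel_right, gen_zero]
      group)

theorem monodromy_gen (v : V) (i : ZMod (T.label v)) :
    T.monodromy (gen v i) =
      (T.offset (T.parent v))⁻¹ * ((gen v (i - 1))⁻¹ * gen v (-1)) * T.offset (T.parent v) :=
  T.rootConj_gen v i

/-- The vertex `o`, as an element of the mapping torus. -/
def vertex (o : Option V) : MappingTorus T.monodromy :=
  ⟨T.offset o, Multiplicative.ofAdd 1⟩

theorem rightHom_vertex (o : Option V) :
    SemidirectProduct.rightHom (T.vertex o) = Multiplicative.ofAdd 1 :=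
  rfl

/-- The atom `c i` of the edge above `v`, as an element of the mapping torus. -/
def atom (v : V) (i : ZMod (T.label v)) : MappingTorus T.monodromy :=
  ⟨gen v i * T.offset (T.parent v), Multiplicative.ofAdd 1⟩

theorem atom_zero (v : V) : T.atom v 0 = T.vertex (T.parent v) := by
  rw [atom, vertex, gen_zero, one_mul]

theorem atom_one (v : V) : T.atom v 1 = T.vertex (some v) := by
  rw [atom, vertex, offset_some]

theorem atom_mul_atom_add_one (v : V) (i : ZMod (T.label v)) :
    T.atom v i * T.atom v (i + 1) = T.atom v (-1) * T.atom v 0 := by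
  ext
  · simp only [atom, SemidirectProduct.mul_left, zpowersHom_apply, toAdd_ofAdd, zpow_one, map_mul,
      monodromy_gen, add_sub_cancel_right, zero_sub]
    group
  · rfl

theorem braidRel_vertex (v : V) :
    BraidRel (T.vertex (T.parent v)) (T.vertex (some v)) (T.label v) := by
  refine (braidRel_iff_exists_zmod _ _ _).2 ⟨T.atom v, T.atom_zero v, T.atom_one v, fun i => ?_⟩
  rw [← atom_zero, ← atom_one, atom_mul_atom_add_one, ← T.atom_mul_atom_add_one v 0, zero_add]

theorem exists_hom_vertex {K : Type*} [Group K] (a : Option V → K)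
    (ha : ∀ v, BraidRel (a (T.parent v)) (a (some v)) (T.label v)) :
    ∃ ρ : MappingTorus T.monodromy →* K, ∀ o, ρ (T.vertex o) = a o := by
  choose c hc0 hc1 hc using fun v => (braidRel_iff_exists_zmod _ _ _).1 (ha v)
  let f : T.FreeFiber →* K := FreeFiber.lift fun v i => c v i * (a (T.parent v))⁻¹
  have hgen (v : V) (i : ZMod (T.label v)) : f (gen v i) = c v i * (a (T.parent v))⁻¹ :=
    FreeFiber.lift_gen _ (fun v => by rw [hc0, mul_inv_cancel]) v i
  have hoffset (o : Option V) : f (T.offset o) = a o * (a none)⁻¹ := by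
    induction o using T.parent_induction with
    | root => rw [offset_none, map_one, mul_inv_cancel]
    | child v ih => rw [offset_some, map_mul, ih, hgen, hc1]; group
  have hmonodromy : f.comp T.monodromy.toMonoidHom =
      (MulAut.conj (a none)).toMonoidHom.comp f := FreeFiber.hom_ext fun v i => by
    have hshift : (c v (i - 1))⁻¹ * c v (-1) = c v i * (a (T.parent v))⁻¹ := by
      rw [inv_mul_eq_iff_eq_mul, ← mul_assoc, eq_mul_inv_iff_mul_eq, ← hc0]
      have h₁ := hc v (i - 1)
      have h₂ := hc v (-1)
      rw [sub_add_cancel] at h₁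
      rw [neg_add_cancel] at h₂
      rw [h₁, h₂]
    simp only [MonoidHom.comp_apply, MulEquiv.toMonoidHom_eq_coe, MonoidHom.coe_coe,
      MulAut.conj_apply, monodromy_gen, map_mul, map_inv, hoffset, hgen, ← hshift]
    group
  refine ⟨MappingTorus.lift f (a none) (DFunLike.congr_fun hmonodromy), fun o => ?_⟩
  simp [MappingTorus.lift, SemidirectProduct.lift, vertex, hoffset]

end LabelledRootedTree

section Forest

variable {V : Type*} (Γ : SimpleGraph V)

/-- The distance from a chosen root of the connected component. -/
noncomputable def componentDepth (v : V) : ℕ :=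
  Γ.dist (Γ.connectedComponentMk v).out v

theorem componentDepth_ne_of_adj {Γ : SimpleGraph V} (hΓ : Γ.IsAcyclic) {u v : V}
    (h : Γ.Adj u v) : componentDepth Γ u ≠ componentDepth Γ v := by
  rw [componentDepth, componentDepth,
    SimpleGraph.ConnectedComponent.connectedComponentMk_eq_of_adj h]
  exact hΓ.dist_ne_of_adj h
    ((SimpleGraph.ConnectedComponent.exact (Quot.out_eq _)).trans h.reachable.symm)

theorem eq_of_adj_of_componentDepth_lt {Γ : SimpleGraph V} (hΓ : Γ.IsAcyclic) {u₁ u₂ v : V}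
    (h₁ : Γ.Adj u₁ v) (hlt₁ : componentDepth Γ u₁ < componentDepth Γ v)
    (h₂ : Γ.Adj u₂ v) (hlt₂ : componentDepth Γ u₂ < componentDepth Γ v) : u₁ = u₂ := by
  classical
  set r := (Γ.connectedComponentMk v).out with hr
  have hrv : Γ.Reachable r v := SimpleGraph.ConnectedComponent.exact (Quot.out_eq _)
  obtain ⟨p, hp, -⟩ := hrv.exists_path_of_dist
  have eq_penultimate {u : V} (h : Γ.Adj u v) (hlt : componentDepth Γ u < componentDepth Γ v) :
      u = p.penultimate := by
    obtain ⟨q, hq, hqlen⟩ := (hrv.trans h.reachable.symm).exists_path_of_dist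
    rw [componentDepth, componentDepth,
      SimpleGraph.ConnectedComponent.connectedComponentMk_eq_of_adj h, ← hr, ← hqlen] at hlt
    have hvq : v ∉ q.support := fun hv =>
      hlt.not_ge ((SimpleGraph.dist_le _).trans (q.length_takeUntil_le_length hv))
    exact hΓ.eq_penultimate_of_adj_end hp h.symm
      (hΓ.mem_support_of_ne_mem_support_of_adj_of_isPath hp hq h.symm hvq)
  rw [eq_penultimate h₁ hlt₁, eq_penultimate h₂ hlt₂]

open Classical in
/-- A neighbour of smaller depth, or `none` for the root of a connected component. -/
noncomputable def forestParent (v : V) : Option V :=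
  if h : ∃ u, Γ.Adj u v ∧ componentDepth Γ u < componentDepth Γ v then some h.choose else none

theorem adj_and_componentDepth_lt_of_forestParent_eq_some {Γ : SimpleGraph V} {u v : V}
    (h : forestParent Γ v = some u) :
    Γ.Adj u v ∧ componentDepth Γ u < componentDepth Γ v := by
  unfold forestParent at h
  split_ifs at h with hex
  exact Option.some.inj h ▸ hex.choose_spec

theorem forestParent_eq_some {Γ : SimpleGraph V} (hΓ : Γ.IsAcyclic) {u v : V} (h : Γ.Adj u v)
    (hlt : componentDepth Γ u < componentDepth Γ v) : forestParent Γ v = some u := by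
  have hex : ∃ u, Γ.Adj u v ∧ componentDepth Γ u < componentDepth Γ v := ⟨u, h, hlt⟩
  rw [forestParent, dif_pos hex, Option.some_inj]
  exact eq_of_adj_of_componentDepth_lt hΓ hex.choose_spec.1 hex.choose_spec.2 h hlt

variable (m : Γ.edgeSet → ℕ)

/-- The tree obtained from an acyclic graph by joining the roots of all connected components to one
new vertex. The new edges have label `0`, so that they impose no relation. The label of an edge of
`Γ` is read off the extension of `m` by zero to all of `Sym2 V`. -/
noncomputable def LabelledRootedTree.ofGraph : LabelledRootedTree V where
  parent := forestParent Γ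
  label v := (forestParent Γ v).elim 0 fun u => Function.extend Subtype.val m 0 s(u, v)
  depth o := o.elim 0 fun v => componentDepth Γ v + 1
  depth_parent_lt v := by
    cases h : forestParent Γ v with
    | none => exact Nat.succ_pos _
    | some u => exact Nat.succ_lt_succ (adj_and_componentDepth_lt_of_forestParent_eq_some h).2

variable {Γ}

theorem LabelledRootedTree.ofGraph_label_of_some {u v : V} (h : forestParent Γ v = some u)
    (huv : Γ.Adj u v) : (ofGraph Γ m).label v = m ⟨s(u, v), huv⟩ := by
  simp only [ofGraph, h, Option.elim_some]
  exact Subtype.val_injective.extend_apply m 0 ⟨s(u, v), huv⟩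

theorem LabelledRootedTree.ofGraph_label_of_none {v : V} (h : forestParent Γ v = none) :
    (ofGraph Γ m).label v = 0 := by
  simp only [ofGraph, h, Option.elim_none]

theorem LabelledRootedTree.forall_braidRel_ofGraph_iff (hΓ : Γ.IsAcyclic) {M : Type*} [Monoid M]
    (a : Option V → M) :
    (∀ v, BraidRel (a ((ofGraph Γ m).parent v)) (a (some v)) ((ofGraph Γ m).label v)) ↔
      ∀ u v (h : Γ.Adj u v), BraidRel (a (some u)) (a (some v)) (m ⟨s(u, v), h⟩) := by
  have parent_eq (v : V) : (ofGraph Γ m).parent v = forestParent Γ v := rfl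
  constructor
  · intro ha
    have of_lt (u v : V) (h : Γ.Adj u v) (hlt : componentDepth Γ u < componentDepth Γ v) :
        BraidRel (a (some u)) (a (some v)) (m ⟨s(u, v), h⟩) := by
      have hparent := forestParent_eq_some hΓ h hlt
      rw [← ofGraph_label_of_some m hparent h, ← hparent]
      exact ha v
    intro u v h
    rcases (componentDepth_ne_of_adj hΓ h).lt_or_gt with hlt | hlt
    · exact of_lt u v h hlt
    · simpa only [Sym2.eq_swap] using (of_lt v u h.symm hlt).symm
  · intro ha v
    rw [parent_eq]
    cases hparent : forestParent Γ v with
    | none =>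
      rw [ofGraph_label_of_none m hparent]
      exact braidRel_zero _ _
    | some u =>
      have huv := (adj_and_componentDepth_lt_of_forestParent_eq_some hparent).1
      rw [ofGraph_label_of_some m hparent huv]
      exact ha u v huv

end Forest

namespace ArtinGroup

variable {V : Type*} {Γ : SimpleGraph V} {m : Γ.edgeSet → ℕ}

/-- The generator of the Artin group that belongs to a vertex. -/
def of (m : Γ.edgeSet → ℕ) (v : V) : ArtinGroup Γ m := PresentedGroup.of v

theorem braidRel_of (u v : V) (h : Γ.Adj u v) :
    BraidRel (of m u) (of m v) (m ⟨s(u, v), h⟩) := by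
  have := PresentedGroup.mk_eq_mk_of_mul_inv_mem (rels := artinRelators Γ m) ⟨u, v, h, rfl⟩
  rwa [map_altProd, map_altProd] at this

section Lift

variable {K : Type*} [Group K] (a : V → K)
  (ha : ∀ u v (h : Γ.Adj u v), BraidRel (a u) (a v) (m ⟨s(u, v), h⟩))

/-- The homomorphism given by elements that satisfy the Artin relations. -/
def lift : ArtinGroup Γ m →* K :=
  PresentedGroup.toGroup (f := a) <| by
    rintro _ ⟨u, v, h, rfl⟩
    rw [map_mul, map_inv, map_altProd, map_altProd, mul_inv_eq_one, FreeGroup.lift_apply_of,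
      FreeGroup.lift_apply_of]
    exact ha u v h

@[simp] theorem lift_of (v : V) : lift a ha (of m v) = a v :=
  PresentedGroup.toGroup.of _

end Lift

theorem hom_ext {K : Type*} [Group K] {f g : ArtinGroup Γ m →* K}
    (h : ∀ v, f (of m v) = g (of m v)) : f = g :=
  PresentedGroup.ext h

/-- The exponent sum of an element of the Artin group, which is `1` for every generator. -/
def exponentSum (m : Γ.edgeSet → ℕ) : ArtinGroup Γ m →* Multiplicative ℤ :=
  lift (fun _ => Multiplicative.ofAdd 1) fun _ _ _ => BraidRel.refl _ _

theorem exponentSum_of (v : V) : exponentSum m (of m v) = Multiplicative.ofAdd 1 :=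
  lift_of _ _ v

theorem exists_injective_mappingTorus (hΓ : Γ.IsAcyclic) (m : Γ.edgeSet → ℕ) :
    ∃ ψ : ArtinGroup Γ m →* MappingTorus (LabelledRootedTree.ofGraph Γ m).monodromy,
      Function.Injective ψ ∧ SemidirectProduct.rightHom.comp ψ = exponentSum m := by
  let T := LabelledRootedTree.ofGraph Γ m
  have forall_braidRel_iff {K : Type _} [Group K] (a : Option V → K) :=
    LabelledRootedTree.forall_braidRel_ofGraph_iff m hΓ a
  let ψ : ArtinGroup Γ m →* MappingTorus T.monodromy :=
    lift (fun v => T.vertex (some v)) ((forall_braidRel_iff T.vertex).1 T.braidRel_vertex)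
  obtain ⟨ρ, hρ⟩ := T.exists_hom_vertex (fun o => o.elim 1 (of m))
    ((forall_braidRel_iff fun o => o.elim 1 (of m)).2 braidRel_of)
  have hρψ : ρ.comp ψ = MonoidHom.id _ := hom_ext fun v => by
    rw [MonoidHom.comp_apply, lift_of, hρ, MonoidHom.id_apply, Option.elim_some]
  exact ⟨ψ, Function.LeftInverse.injective (DFunLike.congr_fun hρψ), hom_ext fun v => by
    rw [MonoidHom.comp_apply, lift_of, exponentSum_of, LabelledRootedTree.rightHom_vertex]⟩

end ArtinGroup

theorem isFreeGroup_of_injective {G H : Type*} [Group G] [Group H] [IsFreeGroup H] (f : G →* H)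
    (hf : Function.Injective f) : IsFreeGroup G :=
  IsFreeGroup.ofMulEquiv (f.ofInjective hf).symm

theorem isFreeGroup_ker_rightHom_comp {G N H : Type*} [Group G] [Group N] [Group H]
    [IsFreeGroup N] {φ : H →* MulAut N} (ψ : G →* N ⋊[φ] H) (hψ : Function.Injective ψ) :
    IsFreeGroup (SemidirectProduct.rightHom.comp ψ).ker := by
  have : IsFreeGroup (SemidirectProduct.rightHom (φ := φ)).ker := by
    rw [← SemidirectProduct.range_inl_eq_ker_rightHom]
    exact IsFreeGroup.ofMulEquiv (MonoidHom.ofInjective SemidirectProduct.inl_injective)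
  rw [← MonoidHom.comap_ker]
  exact isFreeGroup_of_injective (ψ.subgroupComap _) fun x y hxy =>
    Subtype.ext (hψ (congrArg Subtype.val hxy))

theorem ArtinGroup.isFreeGroup_ker_exponentSum {V : Type*} {Γ : SimpleGraph V}
    (hΓ : Γ.IsAcyclic) (m : Γ.edgeSet → ℕ) : IsFreeGroup (exponentSum m).ker := by
  obtain ⟨ψ, hψ, hsum⟩ := exists_injective_mappingTorus hΓ m
  exact hsum ▸ isFreeGroup_ker_rightHom_comp ψ hψ

theorem IsNormallyPolyFree.of_isFreeGroup_ker {G F : Type*} [Group G] [Group F] [IsFreeGroup F]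
    (φ : G →* F) (hφ : IsFreeGroup φ.ker) : IsNormallyPolyFree G := by
  refine ⟨2, ![⊥, φ.ker, ⊤], fun i => ?_, rfl, rfl, fun i => ?_⟩
  · fin_cases i
    · exact inferInstanceAs (⊥ : Subgroup G).Normal
    · exact inferInstanceAs φ.ker.Normal
    · exact inferInstanceAs (⊤ : Subgroup G).Normal
  · fin_cases i
    · refine ⟨bot_le, ?_⟩
      change IsFreeGroup (φ.ker ⧸ (⊥ : Subgroup G).subgroupOf φ.ker)
      exact IsFreeGroup.ofMulEquiv (QuotientGroup.quotientBot.symm.trans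
        (QuotientGroup.quotientMulEquivOfEq (Subgroup.bot_subgroupOf _).symm))
    · refine ⟨le_top, ?_⟩
      change IsFreeGroup ((⊤ : Subgroup G) ⧸ φ.ker.subgroupOf ⊤)
      exact isFreeGroup_of_injective (QuotientGroup.kerLift (φ.comp (⊤ : Subgroup G).subtype))
        (QuotientGroup.kerLift_injective _)

theorem mainTheorem7_general {V : Type*} (Γ : SimpleGraph V) (m : Γ.edgeSet → ℕ)
    (hΓ : Γ.IsAcyclic) : IsNormallyPolyFree (ArtinGroup Γ m) :=
  have : IsFreeGroup (Multiplicative ℤ) :=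
    IsFreeGroup.ofMulEquiv (FreeGroup.mulEquivIntOfUnique (α := Unit))
  IsNormallyPolyFree.of_isFreeGroup_ker _ (ArtinGroup.isFreeGroup_ker_exponentSum hΓ m)

theorem mainTheorem7 {V : Type*} [Finite V] (Γ : SimpleGraph V) (m : Γ.edgeSet → ℕ)
    (hm : ∀ e, 2 ≤ m e) (hΓ : Γ.IsTree) :
    IsNormallyPolyFree (ArtinGroup Γ m) :=
  mainTheorem7_general Γ m hΓ.isAcyclic
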